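/- Let $m$ be a natural number and let $\mathbb{R}_m$ be the real Clifford algebra of dimension $2^m$ generated by an orthonormal basis $e_1,\dots,e_m$ of $\mathbb{R}^m$ with $e_j^2=-1$ and $e_ie_j=-e_je_i$ for $i\neq j$. Let $\lambda\mapsto\bar\lambda$ be the real-linear map of $\mathbb{R}_m$ with $\overline{\lambda\mu}=\bar\mu\bar\lambda$, $\bar 1=1$ and $\overline{e_j}=-e_j$. Let $\partial_xf=\sum_{j=1}^m e_j\,\partial_{x_j}f$ be the Dirac operator, let $B(1)$ be the open unit ball of $\mathbb{R}^m$, and let $C^2(\overline{B(1)},\mathbb{R}_m)$ be the space of $\mathbb{R}_m$-valued functions that are twice continuously differentiable on the unit ball up to the boundary. Let $c\ge 0$ and $\alpha>-1$. For $f\in C^2(\overline{B(1)},\mathbb{R}_m)$ and $x\in B(1)$ put $$\mathcal{L}_{c,\alpha}f(x)=(1-|x|^2)^{-\alpha}\,\partial_x\big((1-|x|^2)^{\alpha+1}\,\partial_xf(x)\big)+4\pi^2c^2|x|^2f(x),$$ and for $\mathbb{R}_m$-valued functions $u,v$ on $B(1)$ put $$\langle u,v\rangle_\alpha=\int_{B(1)}\overline{u(x)}\,v(x)\,(1-|x|^2)^\alpha\,dx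 .$$ **Theorem.** $\mathcal{L}_{c,\alpha}$ is self-adjoint (symmetric) with respect to the weighted inner product: for all $f,g\in C^2(\overline{B(1)},\mathbb{R}_m)$ the integrands of $\langle f,\mathcal{L}_{c,\alpha}g\rangle_\alpha$ and $\langle\mathcal{L}_{c,\alpha}f,g\rangle_\alpha$ are integrable on $B(1)$, and $$\langle f,\mathcal{L}_{c,\alpha}g\rangle_\alpha=\langle\mathcal{L}_{c,\alpha}f,g\rangle_\alpha .$$ -/

import Mathlib

noncomputable section

namespace CliffordBall

/-- Euclidean `m`-space. -/
abbrev E (m : ℕ) : Type := EuclideanSpace ℝ (Fin m)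

/-- The quadratic form `x ↦ -|x|²` on Euclidean `m`-space. -/
def negSq (m : ℕ) : QuadraticForm ℝ (E m) := -(LinearMap.BilinMap.toQuadraticMap (innerₗ (E m)))

theorem negSq_apply (m : ℕ) (x : E m) : negSq m x = -‖x‖ ^ 2 := by
  simp [negSq]

/-- The real Clifford algebra `ℝ_m`, generated by `ℝ^m` with `x² = -|x|²`.
Its `star` (from Mathlib) is the conjugation: the real-linear anti-automorphism with
`star (e j) = -e j`. -/
abbrev Cl (m : ℕ) : Type := CliffordAlgebra (negSq m)

/-- The generators `e_j` of `ℝ_m`, the images of the standard orthonormal basis of `ℝ^m`. -/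
def e {m : ℕ} (j : Fin m) : Cl m := CliffordAlgebra.ι (negSq m) (EuclideanSpace.single j 1)

theorem e_mul_self {m : ℕ} (j : Fin m) : e j * e j = -1 := by
  rw [e, CliffordAlgebra.ι_sq_scalar, negSq_apply]
  simp

theorem polar_single {m : ℕ} {i j : Fin m} (h : i ≠ j) :
    QuadraticMap.polar (negSq m) (EuclideanSpace.single j (1 : ℝ))
      (EuclideanSpace.single i 1) = 0 := by
  simp only [QuadraticMap.polar, negSq_apply]
  rw [← real_inner_self_eq_norm_sq, inner_add_add_self]
  simp [EuclideanSpace.inner_single_left, h, h.symm]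

theorem e_mul_e_of_ne {m : ℕ} {i j : Fin m} (h : i ≠ j) : e j * e i = -(e i * e j) := by
  rw [eq_neg_iff_add_eq_zero, e, e, CliffordAlgebra.ι_mul_ι_add_swap, polar_single h, map_zero]

theorem star_e {m : ℕ} (j : Fin m) : star (e j) = -e j := CliffordAlgebra.star_ι _

/-- The basis `e_A`, `A ⊆ {1, …, m}`, of `ℝ_m`, obtained from the basis of wedge products of the
exterior algebra; `basis_apply` below identifies `e_A` with the ordered product of the `e_j`,
`j ∈ A`. -/
def basis (m : ℕ) : Module.Basis (Finset (Fin m)) ℝ (Cl m) :=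
  (EuclideanSpace.basisFun (Fin m) ℝ).toBasis.ExteriorAlgebra.map
    (CliffordAlgebra.equivExterior (negSq m)).symm

theorem contractLeft_prod {m : ℕ} {Q : QuadraticForm ℝ (E m)} (d : Module.Dual ℝ (E m))
    (l : List (Fin m)) (h : ∀ j ∈ l, d (EuclideanSpace.single j 1) = 0) :
    CliffordAlgebra.contractLeft d
      (l.map fun j => CliffordAlgebra.ι Q (EuclideanSpace.single j (1 : ℝ))).prod = 0 := by
  induction l with
  | nil => simp
  | cons a l ih =>
    rw [List.map_cons, List.prod_cons, CliffordAlgebra.contractLeft_ι_mul,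
      ih fun j hj => h j (List.mem_cons_of_mem _ hj), h a List.mem_cons_self]
    simp

theorem equivExterior_prod {m : ℕ} (l : List (Fin m)) (hl : l.Nodup) :
    CliffordAlgebra.equivExterior (negSq m) (l.map e).prod =
      (l.map fun j => ExteriorAlgebra.ι ℝ (EuclideanSpace.single j (1 : ℝ) : E m)).prod := by
  induction l with
  | nil => simp [CliffordAlgebra.changeFormEquiv]
  | cons a l ih =>
    rw [List.nodup_cons] at hl
    have ih := ih hl.2
    simp only [CliffordAlgebra.equivExterior, CliffordAlgebra.changeFormEquiv_apply] at ih ⊢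
    rw [List.map_cons, List.prod_cons, e, CliffordAlgebra.changeForm_ι_mul, ih, List.map_cons,
      List.prod_cons]
    refine sub_eq_self.2 (contractLeft_prod _ _ fun j hj => ?_)
    have hne : a ≠ j := fun h => hl.1 (h ▸ hj)
    have hp := polar_single hne.symm
    rw [QuadraticMap.polar] at hp
    rw [QuadraticMap.associated_apply]
    simp only [neg_apply]
    rw [show -negSq m (EuclideanSpace.single a 1 + EuclideanSpace.single j 1)
      - -negSq m (EuclideanSpace.single a 1) - -negSq m (EuclideanSpace.single j 1) = 0 by linarith,
      smul_zero]

theorem basis_apply {m : ℕ} (A : Finset (Fin m)) : basis m A = (A.sort.map e).prod := by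
  rw [basis, Module.Basis.map_apply, LinearEquiv.symm_apply_eq, equivExterior_prod _ (A.sort_nodup _),
    ExteriorAlgebra.basis_apply_ofCard _ (rfl : A.card = A.card),
    ← Finset.listMap_orderEmbOfFin_finRange A rfl, List.map_map]
  refine (ExteriorAlgebra.ιMulti_apply ..).trans ?_
  rw [List.ofFn_eq_map]
  congr 1
  refine List.map_congr_left fun i _ => ?_
  simp only [Function.comp_apply, OrthonormalBasis.coe_toBasis, EuclideanSpace.basisFun_apply]
  rfl

/-- The linear map taking `λ = ∑_A λ_A e_A` to the family `(λ_A)_A`, regarded as a vector of a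
Euclidean space. -/
def coords (m : ℕ) : Cl m ≃ₗ[ℝ] EuclideanSpace ℝ (Finset (Fin m)) :=
  (basis m).equivFun.trans (WithLp.linearEquiv 2 ℝ (Finset (Fin m) → ℝ)).symm

/-- The norm `|λ| = (∑_A λ_A²)^{1/2}` on `ℝ_m`. -/
instance (m : ℕ) : NormedAddCommGroup (Cl m) :=
  NormedAddCommGroup.induced (Cl m) (EuclideanSpace ℝ (Finset (Fin m))) (coords m)
    (coords m).injective

instance (m : ℕ) : NormedSpace ℝ (Cl m) :=
  NormedSpace.induced ℝ (Cl m) (EuclideanSpace ℝ (Finset (Fin m))) (coords m)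

theorem norm_sq_eq {m : ℕ} (a : Cl m) : ‖a‖ ^ 2 = ∑ A, (basis m).repr a A ^ 2 := by
  change ‖coords m a‖ ^ 2 = _
  rw [EuclideanSpace.real_norm_sq_eq]
  rfl

/-- The Dirac operator `∂_x f = ∑_j e_j ∂f/∂x_j`, acting from the left. -/
def dirac {m : ℕ} (f : E m → Cl m) (x : E m) : Cl m :=
  ∑ j : Fin m, e j * fderiv ℝ f x (EuclideanSpace.single j 1)

/-- The operator
`L_{c,α} f = (1 - |x|²)^{-α} ∂_x ((1 - |x|²)^{α+1} ∂_x f) + 4 π² c² |x|² f`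
(meaningful at points `x` of the open unit ball). -/
def opL {m : ℕ} (c α : ℝ) (f : E m → Cl m) (x : E m) : Cl m :=
  (1 - ‖x‖ ^ 2) ^ (-α) • dirac (fun y => (1 - ‖y‖ ^ 2) ^ (α + 1) • dirac f y) x
    + (4 * Real.pi ^ 2 * c ^ 2 * ‖x‖ ^ 2) • f x

/-- The integrand `conj(f(x)) g(x) (1 - |x|²)^α` of the weighted Clifford inner product. -/
def pairing {m : ℕ} (α : ℝ) (f g : E m → Cl m) (x : E m) : Cl m :=
  (1 - ‖x‖ ^ 2) ^ α • (star (f x) * g x)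

/-- The weighted Clifford-valued inner product
`⟨f, g⟩_α = ∫_{B(1)} conj(f(x)) g(x) (1 - |x|²)^α dx`. -/
def wInner {m : ℕ} (α : ℝ) (f g : E m → Cl m) : Cl m :=
  ∫ x in Metric.ball (0 : E m) 1, pairing α f g x

end CliffordBall

end

/-! Write ρ = 1 - |x|². On the ball the difference of the two integrands is the divergence of
ρ^(α+1) V, where V_j = conj(f) e_j ∂g + conj(∂f) e_j g (`greenField`). This is algebra
(`green_identity`): the cross terms conj(∂f) ∂g cancel because conj(e_j) = -e_j, and the potential
terms cancel because 4π²c²|x|² is a real scalar.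

It remains to see that such a divergence integrates to zero
(`integral_fderiv_one_sub_norm_sq_rpow_smul`). The field vanishes on the sphere since α + 1 > 0, but
its derivative is only ρ^α times a function continuous on the closed ball: possibly unbounded, yet
integrable since α > -1. So the field is multiplied by a cutoff in nρ, the integral of the
derivative of the resulting compactly supported field is zero, and n → ∞ by dominated convergence.
-/

open MeasureTheory Metric Filter Topology Set

/-! ### Integrability of the weight (1 - |x|²)^α on the ball -/

section BallWeight

variable {E V : Type*} [NormedAddCommGroup E] [NormedAddCommGroup V]

theorem one_sub_norm_sq_pos {x : E} (hx : x ∈ ball (0 : E) 1) : 0 < 1 - ‖x‖ ^ 2 := by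
  rw [mem_ball_zero_iff] at hx
  nlinarith [norm_nonneg x]

theorem closedBall_mem_nhds_of_mem_ball {x : E} (hx : x ∈ ball (0 : E) 1) :
    closedBall (0 : E) 1 ∈ 𝓝 x :=
  mem_of_superset (isOpen_ball.mem_nhds hx) ball_subset_closedBall

/-- Radial form of the weight, with y ^ d the polar Jacobian. Only the factor (1 - y)^α can be
singular on [0, 1]; the others are continuous. -/
theorem intervalIntegrable_pow_mul_one_sub_sq_rpow (d : ℕ) {α : ℝ} (hα : -1 < α) :
    IntervalIntegrable (fun y : ℝ => y ^ d * (1 + y) ^ α * (1 - y) ^ α) volume 0 1 := by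
  have h : IntervalIntegrable (fun y : ℝ => (1 - y) ^ α) volume 0 1 := by
    simpa using (intervalIntegral.intervalIntegrable_rpow' (a := 1) (b := 0) hα).comp_sub_left 1
  refine h.continuousOn_mul ((continuousOn_id.pow d).mul
    (ContinuousOn.rpow_const (by fun_prop) fun y hy => Or.inl ?_))
  rw [uIcc_of_le zero_le_one] at hy
  linarith [hy.1]

theorem integrableOn_one_sub_norm_sq_rpow [NormedSpace ℝ E] [FiniteDimensional ℝ E]
    [MeasurableSpace E] [BorelSpace E] (μ : Measure E) [μ.IsAddHaarMeasure] {α : ℝ}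
    (hα : -1 < α) : IntegrableOn (fun x : E => (1 - ‖x‖ ^ 2) ^ α) (ball 0 1) μ := by
  -- Polar coordinates need a nontrivial space; in dimension 0 the weight is constantly 1.
  rcases subsingleton_or_nontrivial E with hE | hE
  · have h : (fun x : E => (1 - ‖x‖ ^ 2) ^ α) = fun _ => 1 := by
      ext x
      simp [Subsingleton.elim x 0]
    rw [h]
    exact integrableOn_const measure_ball_lt_top.ne
  · refine (integrableOn_fun_norm_addHaar μ (f := fun y => (1 - y ^ 2) ^ α)).2 ?_
    refine ((intervalIntegrable_iff_integrableOn_Ioo_of_le zero_le_one).1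
      (intervalIntegrable_pow_mul_one_sub_sq_rpow (Module.finrank ℝ E - 1) hα)).congr_fun
      (fun y hy => ?_) measurableSet_Ioo
    have h1 : 0 ≤ 1 + y := by linarith [hy.1]
    have h2 : 0 ≤ 1 - y := by linarith [hy.2]
    simp only [smul_eq_mul]
    rw [mul_assoc, ← Real.mul_rpow h1 h2]
    ring_nf

theorem integrableOn_one_sub_norm_sq_rpow_smul [NormedSpace ℝ V] [NormedSpace ℝ E]
    [FiniteDimensional ℝ E] [MeasurableSpace E] [BorelSpace E] (μ : Measure E) [μ.IsAddHaarMeasure] {α : ℝ}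
    (hα : -1 < α) {K : E → V} (hK : ContinuousOn K (closedBall 0 1)) :
    IntegrableOn (fun x : E => (1 - ‖x‖ ^ 2) ^ α • K x) (ball 0 1) μ := by
  have hw := integrableOn_one_sub_norm_sq_rpow μ hα
  obtain ⟨C, hC⟩ := (isCompact_closedBall (0 : E) 1).exists_bound_of_continuousOn hK
  have : ProperSpace E := FiniteDimensional.proper ℝ E
  refine (hw.mul_const C).mono' (hw.aestronglyMeasurable.smul
    ((hK.mono ball_subset_closedBall).aestronglyMeasurable measurableSet_ball)) ?_
  refine (ae_restrict_mem measurableSet_ball).mono fun x hx => ?_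
  have hρ := Real.rpow_nonneg (one_sub_norm_sq_pos hx).le α
  rw [norm_smul, Real.norm_of_nonneg hρ]
  exact mul_le_mul_of_nonneg_left (hC x (ball_subset_closedBall hx)) hρ

end BallWeight

/-! ### Cutoffs and the weighted divergence theorem -/

section Cutoff

/-- There is a uniform bound for `s ψ'(s - 1)`, `ψ` the smooth transition function. -/
theorem exists_bound_mul_deriv_smoothTransition :
    ∃ C : ℝ, ∀ s : ℝ, |s * deriv Real.smoothTransition (s - 1)| ≤ C := by
  have hd : Continuous (deriv Real.smoothTransition) :=
    (Real.smoothTransition.contDiff (n := 1)).continuous_deriv le_rfl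
  obtain ⟨C, hC⟩ := (isCompact_Icc (a := (0 : ℝ)) (b := 2)).exists_bound_of_continuousOn
    (f := fun s => s * deriv Real.smoothTransition (s - 1)) (by fun_prop)
  refine ⟨C, fun s => ?_⟩
  by_cases hs : s ∈ Icc (0 : ℝ) 2
  · exact hC s hs
  have hC0 : 0 ≤ C := (norm_nonneg _).trans (hC 0 (by simp))
  -- Off [0, 2] the argument s - 1 lies outside [0, 1], where the transition function is locally
  -- constant.
  suffices deriv Real.smoothTransition (s - 1) = 0 by simpa [this]
  rcases lt_or_ge s 0 with h | h
  · have : Real.smoothTransition =ᶠ[𝓝 (s - 1)] fun _ => 0 := by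
      filter_upwards [Iio_mem_nhds (show s - 1 < 0 by linarith)] with y hy
      exact Real.smoothTransition.zero_of_nonpos (le_of_lt hy)
    rw [this.deriv_eq, deriv_const]
  · have h2 : 1 < s - 1 := by
      by_contra hc
      exact hs ⟨h, by linarith⟩
    have : Real.smoothTransition =ᶠ[𝓝 (s - 1)] fun _ => 1 := by
      filter_upwards [Ioi_mem_nhds h2] with y hy
      exact Real.smoothTransition.one_of_one_le (le_of_lt hy)
    rw [this.deriv_eq, deriv_const]

variable {E V : Type*} [NormedAddCommGroup E] [NormedAddCommGroup V] [NormedSpace ℝ V]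

/-- A smooth function on `E` that vanishes where `n (1 - |x|²) ≤ 1` and is `1` where
`n (1 - |x|²) ≥ 2`. -/
noncomputable def ballCutoff (n : ℕ) (x : E) : ℝ := Real.smoothTransition (n * (1 - ‖x‖ ^ 2) - 1)

/-- The shift by -1 in the cutoff makes its argument strictly negative already on the sphere, hence
on a neighbourhood. -/
theorem ballCutoff_eventuallyEq_zero (n : ℕ) {x : E} (hx : x ∉ ball (0 : E) 1) :
    ballCutoff n =ᶠ[𝓝 x] fun _ => 0 := by
  have hc : Continuous fun y : E => (n : ℝ) * (1 - ‖y‖ ^ 2) - 1 := by fun_prop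
  rw [mem_ball_zero_iff, not_lt] at hx
  have : (n : ℝ) * (1 - ‖x‖ ^ 2) - 1 < 0 := by
    have h : 1 - ‖x‖ ^ 2 ≤ 0 := by nlinarith
    linarith [mul_nonpos_of_nonneg_of_nonpos (Nat.cast_nonneg (α := ℝ) n) h]
  filter_upwards [hc.continuousAt.eventually (gt_mem_nhds this)] with y hy
  exact Real.smoothTransition.zero_of_nonpos hy.le

variable [InnerProductSpace ℝ E]

theorem contDiff_ballCutoff (n : ℕ) : ContDiff ℝ 1 (ballCutoff n : E → ℝ) :=
  (Real.smoothTransition.contDiff (n := 1)).comp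
    ((contDiff_const.mul (contDiff_const.sub (contDiff_norm_sq ℝ))).sub contDiff_const)

theorem hasFDerivAt_one_sub_norm_sq (x : E) :
    HasFDerivAt (fun y : E => 1 - ‖y‖ ^ 2) (-(2 • innerSL ℝ x)) x :=
  (hasStrictFDerivAt_norm_sq x).hasFDerivAt.const_sub 1

theorem fderiv_ballCutoff_apply (n : ℕ) (x v : E) :
    fderiv ℝ (ballCutoff n) x v =
      deriv Real.smoothTransition (n * (1 - ‖x‖ ^ 2) - 1) * (n * (-(2 * inner ℝ x v))) := by
  have h := (Real.smoothTransition.contDiff (n := 1)).differentiable (by simp)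
    (n * (1 - ‖x‖ ^ 2) - 1)
  have h2 := h.hasDerivAt.comp_hasFDerivAt x
    (((hasFDerivAt_one_sub_norm_sq x).const_mul (n : ℝ)).sub_const 1)
  rw [show (ballCutoff n : E → ℝ) = Real.smoothTransition ∘ fun y => n * (1 - ‖y‖ ^ 2) - 1 from rfl,
    h2.fderiv]
  simp

theorem hasFDerivAt_one_sub_norm_sq_rpow (α : ℝ) {x : E} (hx : x ∈ ball (0 : E) 1) :
    HasFDerivAt (fun y : E => (1 - ‖y‖ ^ 2) ^ (α + 1))
      (((α + 1) * (1 - ‖x‖ ^ 2) ^ α) • (-(2 • innerSL ℝ x) : E →L[ℝ] ℝ)) x := by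
  have h := (hasFDerivAt_one_sub_norm_sq x).rpow_const (p := α + 1)
    (Or.inl (one_sub_norm_sq_pos hx).ne')
  simpa only [add_sub_cancel_right] using h

theorem contDiffAt_one_sub_norm_sq_rpow (α : ℝ) {x : E} (hx : x ∈ ball (0 : E) 1) :
    ContDiffAt ℝ 1 (fun y : E => (1 - ‖y‖ ^ 2) ^ α) x :=
  (contDiffAt_const.sub (contDiff_norm_sq ℝ).contDiffAt).rpow_const_of_ne
    (one_sub_norm_sq_pos hx).ne'

theorem fderiv_one_sub_norm_sq_rpow_smul (α : ℝ) {x : E} (hx : x ∈ ball (0 : E) 1) {G : E → V}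
    (hG : DifferentiableAt ℝ G x) (v : E) :
    fderiv ℝ (fun y => (1 - ‖y‖ ^ 2) ^ (α + 1) • G y) x v = (1 - ‖x‖ ^ 2) ^ α •
      ((1 - ‖x‖ ^ 2) • fderiv ℝ G x v - (2 * (α + 1) * inner ℝ x v) • G x) := by
  have h := (hasFDerivAt_one_sub_norm_sq_rpow α hx).smul hG.hasFDerivAt
  have h2 := congrArg (fun T => T v) h.fderiv
  simp only [Pi.smul_def'] at h2
  refine h2.trans ?_
  have hρ := one_sub_norm_sq_pos hx
  simp only [add_apply, smul_apply, ContinuousLinearMap.smulRight_apply, neg_apply, coe_innerSL_apply,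
    Real.rpow_add_one hρ.ne']
  simp only [nsmul_eq_mul, smul_eq_mul, Nat.cast_ofNat]
  module

theorem uniqueDiffOn_closedBall_zero_one : UniqueDiffOn ℝ (closedBall (0 : E) 1) :=
  uniqueDiffOn_convex (convex_closedBall _ _)
    ⟨0, ball_subset_interior_closedBall (mem_ball_self one_pos)⟩

theorem continuousOn_weighted_fderivWithin (α : ℝ) {G : E → V}
    (hG : ContDiffOn ℝ 1 G (closedBall 0 1)) (v : E) :
    ContinuousOn (fun x => (1 - ‖x‖ ^ 2) • fderivWithin ℝ G (closedBall 0 1) x v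
      - (2 * (α + 1) * inner ℝ x v) • G x) (closedBall 0 1) :=
  ((Continuous.continuousOn (by fun_prop)).smul
    ((hG.continuousOn_fderivWithin uniqueDiffOn_closedBall_zero_one le_rfl).clm_apply
      continuousOn_const)).sub
    ((Continuous.continuousOn (by fun_prop)).smul hG.continuousOn)

theorem fderiv_one_sub_norm_sq_rpow_smul_eq_fderivWithin (α : ℝ) {x : E}
    (hx : x ∈ ball (0 : E) 1) {G : E → V} (hG : ContDiffOn ℝ 1 G (closedBall 0 1)) (v : E) :
    fderiv ℝ (fun y => (1 - ‖y‖ ^ 2) ^ (α + 1) • G y) x v = (1 - ‖x‖ ^ 2) ^ α •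
      ((1 - ‖x‖ ^ 2) • fderivWithin ℝ G (closedBall 0 1) x v
        - (2 * (α + 1) * inner ℝ x v) • G x) := by
  have hs := closedBall_mem_nhds_of_mem_ball hx
  rw [fderivWithin_of_mem_nhds hs, fderiv_one_sub_norm_sq_rpow_smul α hx
    ((hG.contDiffAt hs).differentiableAt (by simp))]

variable [FiniteDimensional ℝ E] [MeasurableSpace E] [BorelSpace E]

/-- The cutoff vanishes near every point outside the open ball, so the product is C¹ with compact
support on all of `E`, however `F` behaves at the boundary. -/
theorem integral_fderiv_ballCutoff_smul (μ : Measure E) [μ.IsAddHaarMeasure] (n : ℕ) {F : E → V}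
    (hF : ∀ x ∈ ball (0 : E) 1, ContDiffAt ℝ 1 F x) (v : E) :
    Continuous (fun x => fderiv ℝ (fun y => ballCutoff n y • F y) x v) ∧
      ∫ x in ball 0 1, fderiv ℝ (fun y => ballCutoff n y • F y) x v ∂μ = 0 := by
  have : ProperSpace E := FiniteDimensional.proper ℝ E
  have hz : ∀ x ∉ ball (0 : E) 1, (fun y => ballCutoff n y • F y) =ᶠ[𝓝 x] fun _ => 0 := by
    intro x hx
    filter_upwards [ballCutoff_eventuallyEq_zero n hx] with y hy
    simp [hy]
  have hH : ContDiff ℝ 1 (fun y => ballCutoff n y • F y) := by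
    rw [contDiff_iff_contDiffAt]
    intro x
    by_cases hx : x ∈ ball (0 : E) 1
    · exact (contDiff_ballCutoff n).contDiffAt.smul (hF x hx)
    · exact contDiffAt_const.congr_of_eventuallyEq (hz x hx)
  have hd : Continuous (fun x => fderiv ℝ (fun y => ballCutoff n y • F y) x v) :=
    (hH.continuous_fderiv one_ne_zero).clm_apply continuous_const
  have hs : HasCompactSupport (fun y => ballCutoff n y • F y) :=
    HasCompactSupport.intro (isCompact_closedBall (0 : E) 1) fun x hx =>
      (hz x fun h => hx (ball_subset_closedBall h)).eq_of_nhds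
  have hsd : HasCompactSupport (fun x => fderiv ℝ (fun y => ballCutoff n y • F y) x v) :=
    HasCompactSupport.intro (isCompact_closedBall (0 : E) 1) fun x hx => by
      simp [(hz x fun h => hx (ball_subset_closedBall h)).fderiv_eq]
  refine ⟨hd, ?_⟩
  rw [setIntegral_eq_integral_of_forall_compl_eq_zero fun x hx => by simp [(hz x hx).fderiv_eq]]
  -- Integration by parts against the constant function 1.
  have h := integral_smul_fderiv_eq_neg_fderiv_smul_of_integrable (μ := μ) (𝕜 := ℝ)
    (f := fun _ : E => (1 : ℝ)) (g := fun y => ballCutoff n y • F y) (v := v) (by simp)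
    (by simpa using hd.integrable_of_hasCompactSupport hsd)
    (by simpa using hH.continuous.integrable_of_hasCompactSupport hs)
    (fun _ _ => differentiableAt_const _) (fun _ _ => hH.differentiable (by simp) _)
  simpa using h

theorem integrableOn_fderiv_one_sub_norm_sq_rpow_smul (μ : Measure E) [μ.IsAddHaarMeasure] {α : ℝ}
    (hα : -1 < α) {G : E → V} (hG : ContDiffOn ℝ 1 G (closedBall 0 1)) (v : E) :
    IntegrableOn (fun x => fderiv ℝ (fun y => (1 - ‖y‖ ^ 2) ^ (α + 1) • G y) x v) (ball 0 1) μ :=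
  (integrableOn_one_sub_norm_sq_rpow_smul μ hα
    (continuousOn_weighted_fderivWithin α hG v)).congr_fun
    (fun _ hx => (fderiv_one_sub_norm_sq_rpow_smul_eq_fderivWithin α hx hG v).symm)
    measurableSet_ball

theorem integral_fderiv_one_sub_norm_sq_rpow_smul (μ : Measure E) [μ.IsAddHaarMeasure] {α : ℝ}
    (hα : -1 < α) {G : E → V} (hG : ContDiffOn ℝ 1 G (closedBall 0 1)) (v : E) :
    ∫ x in ball 0 1, fderiv ℝ (fun y => (1 - ‖y‖ ^ 2) ^ (α + 1) • G y) x v ∂μ = 0 := by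
  set F : E → V := fun y => (1 - ‖y‖ ^ 2) ^ (α + 1) • G y with hFdef
  have hGat : ∀ x ∈ ball (0 : E) 1, ContDiffAt ℝ 1 G x := fun x hx =>
    hG.contDiffAt (closedBall_mem_nhds_of_mem_ball hx)
  have hF : ∀ x ∈ ball (0 : E) 1, ContDiffAt ℝ 1 F x := fun x hx =>
    (contDiffAt_one_sub_norm_sq_rpow _ hx).smul (hGat x hx)
  obtain ⟨C, hC⟩ := exists_bound_mul_deriv_smoothTransition
  have hbound : ∀ n : ℕ, ∀ x ∈ ball (0 : E) 1,
      ‖fderiv ℝ (fun y => ballCutoff n y • F y) x v‖ ≤ ‖fderiv ℝ F x v‖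
        + C * ‖(1 - ‖x‖ ^ 2) ^ α • ((2 * inner ℝ x v) • G x)‖ := by
    intro n x hx
    have hρ := one_sub_norm_sq_pos hx
    have h := ((contDiff_ballCutoff n).differentiable (by simp) x).hasFDerivAt.smul
      ((hF x hx).differentiableAt (by simp)).hasFDerivAt
    have h2 := congrArg (fun T => T v) h.fderiv
    simp only [Pi.smul_def'] at h2
    rw [h2]
    simp only [add_apply, smul_apply, ContinuousLinearMap.smulRight_apply]
    refine (norm_add_le _ _).trans (add_le_add ?_ ?_)
    · rw [norm_smul, ballCutoff, Real.norm_of_nonneg (Real.smoothTransition.nonneg _)]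
      exact mul_le_of_le_one_left (norm_nonneg _) (Real.smoothTransition.le_one _)
    -- One power of ρ from ρ^(α+1) absorbs the factor n: with s = nρ the coefficient is -s ψ'(s -
    -- 1), bounded uniformly in n.
    · have hE : fderiv ℝ (ballCutoff n) x v • F x =
          (-(n * (1 - ‖x‖ ^ 2) * deriv Real.smoothTransition (n * (1 - ‖x‖ ^ 2) - 1))) •
            ((1 - ‖x‖ ^ 2) ^ α • ((2 * inner ℝ x v) • G x)) := by
        rw [fderiv_ballCutoff_apply, hFdef]
        simp only [smul_smul, Real.rpow_add_one hρ.ne']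
        congr 1
        ring
      rw [hE, norm_smul, norm_neg]
      exact mul_le_mul_of_nonneg_right (hC _) (norm_nonneg _)
  have hlim : ∀ x ∈ ball (0 : E) 1, Tendsto
      (fun n : ℕ => fderiv ℝ (fun y => ballCutoff n y • F y) x v) atTop (𝓝 (fderiv ℝ F x v)) := by
    intro x hx
    have hρ := one_sub_norm_sq_pos hx
    -- At a fixed x the sequence is eventually constant: once nρ > 2 the cutoff is 1 near x.
    refine tendsto_const_nhds.congr' ?_
    filter_upwards [(tendsto_natCast_atTop_atTop.atTop_mul_const hρ).eventually
      (eventually_gt_atTop (2 : ℝ))] with n hn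
    have hc : Continuous fun y : E => (n : ℝ) * (1 - ‖y‖ ^ 2) := by fun_prop
    have he : (fun y => ballCutoff n y • F y) =ᶠ[𝓝 x] F := by
      filter_upwards [hc.continuousAt.eventually (lt_mem_nhds hn)] with y hy
      rw [ballCutoff, Real.smoothTransition.one_of_one_le (by linarith), one_smul]
    rw [he.fderiv_eq]
  have hT := tendsto_integral_of_dominated_convergence (μ := μ.restrict (ball (0 : E) 1)) _
    (fun n => (integral_fderiv_ballCutoff_smul μ n hF v).1.aestronglyMeasurable)
    ((integrableOn_fderiv_one_sub_norm_sq_rpow_smul μ hα hG v).norm.add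
      ((integrableOn_one_sub_norm_sq_rpow_smul μ hα (K := fun x => (2 * inner ℝ x v) • G x)
        ?_).norm.const_mul C))
    (fun n => (ae_restrict_mem measurableSet_ball).mono (hbound n))
    ((ae_restrict_mem measurableSet_ball).mono hlim)
  · simp only [(integral_fderiv_ballCutoff_smul μ _ hF v).2] at hT
    exact tendsto_nhds_unique hT tendsto_const_nhds
  · exact (Continuous.continuousOn (by fun_prop)).smul hG.continuousOn

end Cutoff

/-! ### Calculus of Clifford-valued functions -/

namespace CliffordBall

instance (m : ℕ) : FiniteDimensional ℝ (Cl m) := (basis m).finiteDimensional_of_finite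

/-- Multiplication of `ℝ_m` as a continuous bilinear map. -/
noncomputable def mulL (m : ℕ) : Cl m →L[ℝ] Cl m →L[ℝ] Cl m :=
  (LinearMap.mul ℝ (Cl m)).toContinuousBilinearMap

theorem mulL_apply {m : ℕ} (a b : Cl m) : mulL m a b = a * b := rfl

/-- Conjugation of `ℝ_m` as a continuous linear map. -/
noncomputable def starL (m : ℕ) : Cl m →L[ℝ] Cl m :=
  LinearMap.toContinuousLinearMap
    { toFun := star
      map_add' := star_add
      map_smul' := CliffordAlgebra.star_smul }

section Calculus

variable {m : ℕ} {X : Type*} [NormedAddCommGroup X] {u v : X → Cl m} {s : Set X}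

theorem continuousOn_mul (hu : ContinuousOn u s) (hv : ContinuousOn v s) :
    ContinuousOn (fun x => u x * v x) s :=
  ((mulL m).continuous.comp_continuousOn hu).clm_apply hv

theorem continuousOn_star (hu : ContinuousOn u s) : ContinuousOn (fun x => star (u x)) s :=
  (starL m).continuous.comp_continuousOn hu

variable [NormedSpace ℝ X]

theorem contDiffOn_mul {n : WithTop ℕ∞} (hu : ContDiffOn ℝ n u s) (hv : ContDiffOn ℝ n v s) :
    ContDiffOn ℝ n (fun x => u x * v x) s :=
  ((mulL m).contDiff.comp_contDiffOn hu).clm_apply hv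

theorem contDiffOn_star {n : WithTop ℕ∞} (hu : ContDiffOn ℝ n u s) :
    ContDiffOn ℝ n (fun x => star (u x)) s :=
  (starL m).contDiff.comp_contDiffOn hu

theorem fderiv_mul_apply {x : X} (hu : DifferentiableAt ℝ u x) (hv : DifferentiableAt ℝ v x)
    (w : X) : fderiv ℝ (fun y => u y * v y) x w =
      fderiv ℝ u x w * v x + u x * fderiv ℝ v x w := by
  have h := ((mulL m).hasFDerivAt_of_bilinear hu.hasFDerivAt hv.hasFDerivAt).fderiv
  refine (congrArg (fun T => T w) h).trans ?_
  simp [mulL_apply, add_comm]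

theorem differentiableAt_mul {x : X} (hu : DifferentiableAt ℝ u x) (hv : DifferentiableAt ℝ v x) :
    DifferentiableAt ℝ (fun y => u y * v y) x :=
  ((mulL m).hasFDerivAt_of_bilinear hu.hasFDerivAt hv.hasFDerivAt).differentiableAt

theorem hasFDerivAt_star {x : X} (hu : DifferentiableAt ℝ u x) :
    HasFDerivAt (fun y => star (u y)) (starL m ∘L fderiv ℝ u x) x :=
  (starL m).hasFDerivAt.comp x hu.hasFDerivAt

theorem fderiv_star_apply {x : X} (hu : DifferentiableAt ℝ u x) (w : X) :
    fderiv ℝ (fun y => star (u y)) x w = star (fderiv ℝ u x w) := by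
  rw [(hasFDerivAt_star hu).fderiv]
  rfl

end Calculus

/-! ### The operators up to the boundary -/

/-- The Dirac operator on the closed unit ball, with one-sided derivatives on the boundary. -/
noncomputable def diracWithin {m : ℕ} (f : E m → Cl m) (x : E m) : Cl m :=
  ∑ j : Fin m, e j * fderivWithin ℝ f (closedBall 0 1) x (EuclideanSpace.single j 1)

theorem diracWithin_eq {m : ℕ} (f : E m → Cl m) {x : E m} (hx : x ∈ ball (0 : E m) 1) :
    diracWithin f x = dirac f x := by
  rw [diracWithin, dirac, fderivWithin_of_mem_nhds (closedBall_mem_nhds_of_mem_ball hx)]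

theorem contDiffOn_diracWithin {m : ℕ} {f : E m → Cl m}
    (hf : ContDiffOn ℝ 2 f (closedBall 0 1)) : ContDiffOn ℝ 1 (diracWithin f) (closedBall 0 1) :=
  ContDiffOn.sum fun _ _ => contDiffOn_mul contDiffOn_const
    ((hf.fderivWithin uniqueDiffOn_closedBall_zero_one (by norm_num)).clm_apply contDiffOn_const)

/-- The operator `L_{c,α}` with the derivative of the weight carried out; the expression makes
sense up to the boundary. -/
noncomputable def opLWithin {m : ℕ} (c α : ℝ) (f : E m → Cl m) (x : E m) : Cl m :=
  ∑ j : Fin m, e j * ((1 - ‖x‖ ^ 2) • fderivWithin ℝ (diracWithin f) (closedBall 0 1) x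
      (EuclideanSpace.single j 1)
    - (2 * (α + 1) * inner ℝ x (EuclideanSpace.single j 1)) • diracWithin f x)
    + (4 * Real.pi ^ 2 * c ^ 2 * ‖x‖ ^ 2) • f x

theorem continuousOn_opLWithin {m : ℕ} (c α : ℝ) {f : E m → Cl m}
    (hf : ContDiffOn ℝ 2 f (closedBall 0 1)) :
    ContinuousOn (opLWithin c α f) (closedBall 0 1) :=
  ContinuousOn.add (continuousOn_finsetSum _ fun _ _ => continuousOn_mul continuousOn_const
    (continuousOn_weighted_fderivWithin α (contDiffOn_diracWithin hf) _))
    (ContinuousOn.smul (f := fun x : E m => 4 * Real.pi ^ 2 * c ^ 2 * ‖x‖ ^ 2)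
      (Continuous.continuousOn (by fun_prop)) hf.continuousOn)

/-- Differentiating ρ^(α+1) leaves a common factor ρ^α, which ρ^(-α) cancels. Thus the operator
extends continuously to the closed ball, which makes the pairings integrable. -/
theorem opL_eq_opLWithin {m : ℕ} (c α : ℝ) {f : E m → Cl m}
    (hf : ContDiffOn ℝ 2 f (closedBall 0 1)) {x : E m} (hx : x ∈ ball (0 : E m) 1) :
    opL c α f x = opLWithin c α f x := by
  have hρ := one_sub_norm_sq_pos hx
  have he : (fun y => (1 - ‖y‖ ^ 2) ^ (α + 1) • dirac f y) =ᶠ[𝓝 x]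
      fun y => (1 - ‖y‖ ^ 2) ^ (α + 1) • diracWithin f y := by
    filter_upwards [isOpen_ball.mem_nhds hx] with y hy
    rw [diracWithin_eq f hy]
  rw [opL, opLWithin, dirac, he.fderiv_eq]
  simp only [fderiv_one_sub_norm_sq_rpow_smul_eq_fderivWithin α hx (contDiffOn_diracWithin hf),
    mul_smul_comm]
  rw [← Finset.smul_sum, smul_smul, ← Real.rpow_add hρ, neg_add_cancel, Real.rpow_zero, one_smul]

theorem star_smul_real {m : ℕ} (r : ℝ) (a : Cl m) : star (r • a) = r • star a :=
  CliffordAlgebra.star_smul r a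

/-! ### Green's identity -/

/-- Pointwise form at x: a, b are the values of f, g; a', b' their Dirac derivatives; p, q, p', q'
the partial derivatives of these four; r = ρ, t_j = 2(α+1)x_j, k = 4π²c²|x|². -/
theorem green_identity {m : ℕ} (a b : Cl m) (p q p' q' : Fin m → Cl m) (t : Fin m → ℝ) (r k : ℝ)
    (a' b' : Cl m) (ha : a' = ∑ j, e j * p j) (hb : b' = ∑ j, e j * q j) :
    star a * (∑ j, e j * (r • q' j - t j • b') + k • b)
      - star (∑ j, e j * (r • p' j - t j • a') + k • a) * b =
    ∑ j, (r • (star (p j) * (e j * b') + star a * (e j * q' j)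
        + (star (p' j) * (e j * b) + star a' * (e j * q j)))
      - t j • (star a * (e j * b') + star a' * (e j * b))) := by
  -- The sign from conj(e_j) = -e_j makes this sum cancel against `h2`.
  have h1 : ∑ j, star (p j) * (e j * b') = -(star a' * b') := by
    rw [ha, star_sum, Finset.sum_mul, ← Finset.sum_neg_distrib]
    exact Finset.sum_congr rfl fun j _ => by
      rw [star_mul, star_e, mul_neg, neg_mul, neg_neg, mul_assoc]
  have h2 : ∑ j, star a' * (e j * q j) = star a' * b' := by rw [← Finset.mul_sum, ← hb]
  have h3 : ∑ j, (r • (star (p j) * (e j * b') + star a * (e j * q' j)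
        + (star (p' j) * (e j * b) + star a' * (e j * q j)))
      - t j • (star a * (e j * b') + star a' * (e j * b))) =
      ∑ j, (star a * (e j * (r • q' j - t j • b'))
        + (r • star (p' j) - t j • star a') * (e j * b))
      + r • (∑ j, star (p j) * (e j * b') + ∑ j, star a' * (e j * q j)) := by
    rw [← Finset.sum_add_distrib, Finset.smul_sum, ← Finset.sum_add_distrib]
    refine Finset.sum_congr rfl fun j _ => ?_
    simp only [mul_sub, sub_mul, mul_smul_comm, smul_mul_assoc]
    module
  rw [h3, h1, h2, neg_add_cancel, smul_zero, add_zero, Finset.sum_add_distrib, star_add, star_sum,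
    mul_add, add_mul, Finset.mul_sum, Finset.sum_mul, star_smul_real, mul_smul_comm,
    smul_mul_assoc, add_sub_add_right_eq_sub, sub_eq_add_neg, ← Finset.sum_neg_distrib]
  congr 1
  refine Finset.sum_congr rfl fun j _ => ?_
  rw [star_mul, star_e, star_sub, star_smul_real, star_smul_real, mul_neg, neg_mul, neg_neg,
    mul_assoc]

/-- The `j`-th component of the vector field whose weighted divergence is the difference of the
two pairings. -/
noncomputable def greenField {m : ℕ} (f g : E m → Cl m) (j : Fin m) (x : E m) : Cl m :=
  star (f x) * (e j * diracWithin g x) + star (diracWithin f x) * (e j * g x)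

theorem contDiffOn_greenField {m : ℕ} {f g : E m → Cl m}
    (hf : ContDiffOn ℝ 2 f (closedBall 0 1)) (hg : ContDiffOn ℝ 2 g (closedBall 0 1))
    (j : Fin m) : ContDiffOn ℝ 1 (greenField f g j) (closedBall 0 1) :=
  (contDiffOn_mul (contDiffOn_star (hf.of_le one_le_two))
    (contDiffOn_mul contDiffOn_const (contDiffOn_diracWithin hg))).add
  (contDiffOn_mul (contDiffOn_star (contDiffOn_diracWithin hf))
    (contDiffOn_mul contDiffOn_const (hg.of_le one_le_two)))

theorem fderiv_greenField {m : ℕ} {f g : E m → Cl m} {x : E m} (hf : DifferentiableAt ℝ f x)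
    (hg : DifferentiableAt ℝ g x) (hf' : DifferentiableAt ℝ (diracWithin f) x)
    (hg' : DifferentiableAt ℝ (diracWithin g) x) (j : Fin m) (v : E m) :
    fderiv ℝ (greenField f g j) x v =
      star (fderiv ℝ f x v) * (e j * diracWithin g x)
        + star (f x) * (e j * fderiv ℝ (diracWithin g) x v)
        + (star (fderiv ℝ (diracWithin f) x v) * (e j * g x)
          + star (diracWithin f x) * (e j * fderiv ℝ g x v)) := by
  have hc : DifferentiableAt ℝ (fun _ : E m => (e j : Cl m)) x := differentiableAt_const _
  have h1 := (hasFDerivAt_star hf).differentiableAt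
  have h2 := (hasFDerivAt_star hf').differentiableAt
  have h3 := differentiableAt_mul hc hg
  have h4 := differentiableAt_mul hc hg'
  have h := fderiv_fun_add (differentiableAt_mul h1 h4) (differentiableAt_mul h2 h3)
  refine (congrArg (fun T => T v) h).trans ?_
  rw [add_apply, fderiv_mul_apply h1 h4, fderiv_mul_apply h2 h3, fderiv_mul_apply hc hg,
    fderiv_mul_apply hc hg', fderiv_star_apply hf, fderiv_star_apply hf']
  simp

theorem pairing_opL_sub_pairing_opL {m : ℕ} (c α : ℝ) {f g : E m → Cl m}
    (hf : ContDiffOn ℝ 2 f (closedBall 0 1)) (hg : ContDiffOn ℝ 2 g (closedBall 0 1))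
    {x : E m} (hx : x ∈ ball (0 : E m) 1) :
    pairing α f (opL c α g) x - pairing α (opL c α f) g x =
      ∑ j, fderiv ℝ (fun y => (1 - ‖y‖ ^ 2) ^ (α + 1) • greenField f g j y) x
        (EuclideanSpace.single j 1) := by
  have hs := closedBall_mem_nhds_of_mem_ball hx
  have hd : ∀ {h : E m → Cl m}, ContDiffOn ℝ 2 h (closedBall 0 1) →
      DifferentiableAt ℝ h x ∧ DifferentiableAt ℝ (diracWithin h) x := fun hh =>
    ⟨(hh.contDiffAt hs).differentiableAt (by simp),
      ((contDiffOn_diracWithin hh).contDiffAt hs).differentiableAt (by simp)⟩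
  simp only [fderiv_one_sub_norm_sq_rpow_smul_eq_fderivWithin α hx (contDiffOn_greenField hf hg _),
    pairing, opL_eq_opLWithin c α hf hx, opL_eq_opLWithin c α hg hx, opLWithin,
    fderivWithin_of_mem_nhds hs, fderiv_greenField (hd hf).1 (hd hg).1 (hd hf).2 (hd hg).2]
  rw [← smul_sub, ← Finset.smul_sum]
  congr 1
  exact green_identity _ _ _ _ _ _ _ _ _ _ _ (diracWithin_eq f hx) (diracWithin_eq g hx)

/-! ### Integrability of the pairings and symmetry -/

theorem integrableOn_pairing_opL_right {m : ℕ} (c : ℝ) {α : ℝ} (hα : -1 < α) {f g : E m → Cl m}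
    (hf : ContinuousOn f (closedBall 0 1)) (hg : ContDiffOn ℝ 2 g (closedBall 0 1)) :
    IntegrableOn (pairing α f (opL c α g)) (ball 0 1) :=
  (integrableOn_one_sub_norm_sq_rpow_smul volume hα (continuousOn_mul (continuousOn_star hf)
    (continuousOn_opLWithin c α hg))).congr_fun
    (fun x hx => by rw [pairing, opL_eq_opLWithin c α hg hx]) measurableSet_ball

theorem integrableOn_pairing_opL_left {m : ℕ} (c : ℝ) {α : ℝ} (hα : -1 < α) {f g : E m → Cl m}
    (hf : ContDiffOn ℝ 2 f (closedBall 0 1)) (hg : ContinuousOn g (closedBall 0 1)) :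
    IntegrableOn (pairing α (opL c α f) g) (ball 0 1) :=
  (integrableOn_one_sub_norm_sq_rpow_smul volume hα (continuousOn_mul
    (continuousOn_star (continuousOn_opLWithin c α hf)) hg)).congr_fun
    (fun x hx => by rw [pairing, opL_eq_opLWithin c α hf hx]) measurableSet_ball

end CliffordBall

theorem mainTheorem5 (m : ℕ) (c α : ℝ) (hc : 0 ≤ c) (hα : -1 < α)
    (f g : EuclideanSpace ℝ (Fin m) → CliffordBall.Cl m)
    (hf : ContDiffOn ℝ 2 f (Metric.closedBall 0 1))
    (hg : ContDiffOn ℝ 2 g (Metric.closedBall 0 1)) :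
    MeasureTheory.IntegrableOn (CliffordBall.pairing α f (CliffordBall.opL c α g))
      (Metric.ball 0 1) ∧
    MeasureTheory.IntegrableOn (CliffordBall.pairing α (CliffordBall.opL c α f) g)
      (Metric.ball 0 1) ∧
    CliffordBall.wInner α f (CliffordBall.opL c α g) =
      CliffordBall.wInner α (CliffordBall.opL c α f) g := by
  have hfg := CliffordBall.integrableOn_pairing_opL_right c hα hf.continuousOn hg
  have hfg' := CliffordBall.integrableOn_pairing_opL_left c hα hf hg.continuousOn
  refine ⟨hfg, hfg', ?_⟩
  have hG := CliffordBall.contDiffOn_greenField hf hg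
  rw [← sub_eq_zero, CliffordBall.wInner, CliffordBall.wInner, ← integral_sub hfg hfg',
    setIntegral_congr_fun measurableSet_ball fun x hx =>
      CliffordBall.pairing_opL_sub_pairing_opL c α hf hg hx,
    integral_finsetSum _ fun j _ =>
      integrableOn_fderiv_one_sub_norm_sq_rpow_smul volume hα (hG j) _]
  exact Finset.sum_eq_zero fun j _ =>
    integral_fderiv_one_sub_norm_sq_rpow_smul volume hα (hG j) _
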